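/- **Setting.** Let $q(x_1,\dots,x_k)\;{:}{-}\;S_1(\mathbf y_1),\dots,S_l(\mathbf y_l)$ be a full conjunctive query without self-joins: atom $S_j$ has arity $r_j\ge 1$, $\mathbf y_j$ is a vector of $r_j$ distinct variables, and every $x_i$ occurs in some atom. A *fractional edge packing* of $q$ is a vector $\mathbf u=(u_1,\dots,u_l)$ with $u_j\ge 0$ and $\sum_{j:\,x_i\in S_j}u_j\le 1$ for every variable $x_i$; put $u=\sum_j u_j$. A *database* over $[n]$ assigns to each atom $S_j$ a relation $S_j\subseteq[n]^{r_j}$. *Input distributions.* Let $\theta\in(0,1)$. (i) $\mathcal I$ is the uniform distribution on matching databases with $m$ tuples per relation over $[n]$, that is, databases with $|S_j|=m$ for all $j$ in which, for every relation, attribute and value $v\in[n]$, at most one tuple has value $v$ in that attribute; here $m\le n$, and $m\le\theta n$ if some atom has arity $1$. (ii) $\mathcal I^d$ is the uniform distribution on $\theta$-dense databases over $[n]$ with equal cardinalities $m$, that is, databases with $|S_j|=m=\theta n^{r_j}$ for all $j$. *Algorithms.* A one-round algorithm uses $p\ge 1$ machines. Each relation is initially stored at a separate location; machine $c$ receives from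 each $S_j$ a bit string that is a function of $S_j$, and then outputs a set of tuples computed from the strings it received. The output is the union over all machines, and on every instance in the support of the distribution it may contain only tuples of $q(I)$. Machine $c$ has a cost function $g_c:\mathbb Z_{\ge0}\to\mathbb R_{\ge0}$, and the load is the maximum of $g_c(N_c)$ over all machines $c$ and all instances in the support, where $N_c$ is the number of bits received by $c$. *Cost functions.* $g$ is *well-behaved with exponent $a>1$* if $g(0)=0$, $g$ is increasing, and $g((1+\delta)x)\le(1+\delta)^a g(x)$ for all integers $x\ge1$ and real $\delta\ge0$ with $(1+\delta)x$ an integer. Put $g^*(L)=\max\{x: g(x)\le L\}$ ($=\infty$ if there are arbitrarily large such $x$), and let $\bar L_{\mathbf u}$ be the minimum $L\ge0$ such that $$\sum_{c=1}^p g_c^*(L)^u\ \ge\ m^u .$$ **Theorem.** Let $q$, $\theta\in(0,1)$ and $a>1$ be given. 1. There is a constant $C>0$, depending only on $q,\theta,a$, such that for all $n\ge2$, $m$, $p\ge1$, all cost functions $g_1,\dots,g_p$ that are well-behaved with exponent $a$, and all fractional edge packings $\mathbf u$ of $q$: every one-round algorithm that for $I\sim\mathcal I$ outputs in expectation at least $E_{I\sim\mathcal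 I}[|q(I)|]$ tuples has load at least $C\,\bar L_{\mathbf u}$. The same holds for $\mathcal I^d$ in place of $\mathcal I$. 2. The minimum defining $\bar L_{\mathbf u}$ is attained, and if $\mathbf u^*$ is a fractional edge packing of maximum total weight, then $\bar L_{\mathbf u^*}=\max_{\mathbf u}\bar L_{\mathbf u}$, the maximum being over all fractional edge packings $\mathbf u$ of $q$. -/

import Mathlib

open scoped NNReal ENNReal BigOperators

/-- A full conjunctive query `q(x_1,…,x_k) :- S_1(y_1),…,S_l(y_l)` without self-joins.
Atom `j` has its own relation symbol, positive arity `arity j`, and is applied to the pairwise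
distinct variables `vars j 0, vars j 1, …`; every variable of the head occurs in some atom. -/
structure FullCQ where
  /-- number of variables -/
  k : ℕ
  /-- number of atoms -/
  l : ℕ
  arity : Fin l → ℕ
  arity_pos : ∀ j, 0 < arity j
  vars : (j : Fin l) → Fin (arity j) ↪ Fin k
  safe : ∀ i : Fin k, ∃ j, i ∈ Set.range (vars j)

/-- A relation of arity `r` over the domain `[n]`: a finite set of tuples. -/
abbrev DBRel (n r : ℕ) : Type := Finset (Fin r → Fin n)

namespace FullCQ

/-- A database instance for `q` over the domain `[n]`. -/
abbrev Instance (q : FullCQ) (n : ℕ) : Type := (j : Fin q.l) → DBRel n (q.arity j)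

/-- The answer `q(I)`. -/
def eval (q : FullCQ) {n : ℕ} (I : q.Instance n) : Finset (Fin q.k → Fin n) :=
  Finset.univ.filter fun x => ∀ j, (fun i => x (q.vars j i)) ∈ I j

/-- Fractional edge packings of `q`. -/
def IsEdgePacking (q : FullCQ) (u : Fin q.l → ℝ) : Prop :=
  (∀ j, 0 ≤ u j) ∧
    ∀ i : Fin q.k, ∑ j with i ∈ Set.range (q.vars j), u j ≤ 1

/-- Fractional edge packings of `q` of maximum total weight. -/
def IsMaxEdgePacking (q : FullCQ) (u : Fin q.l → ℝ) : Prop :=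
  q.IsEdgePacking u ∧ ∀ u', q.IsEdgePacking u' → ∑ j, u' j ≤ ∑ j, u j

end FullCQ

/-- The relations with exactly `m` tuples in which, for each attribute, every value occurs in at
most one tuple. -/
def matchingRels (n r m : ℕ) : Finset (DBRel n r) :=
  Finset.univ.filter fun S =>
    S.card = m ∧ ∀ i : Fin r, ∀ a ∈ S, ∀ b ∈ S, a i = b i → a = b

/-- The relations with exactly `m` tuples. -/
def sizeRels (n r m : ℕ) : Finset (DBRel n r) :=
  Finset.univ.filter fun S => S.card = m

namespace FullCQ

/-- The matching databases with `m` tuples per relation over `[n]`. -/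
def matchingDBs (q : FullCQ) (n m : ℕ) : Finset (q.Instance n) :=
  Fintype.piFinset fun j => matchingRels n (q.arity j) m

/-- The databases with `m` tuples per relation over `[n]`; these are the `θ`-dense databases when
`m = θ * n ^ r_j` for every atom `j`. -/
def denseDBs (q : FullCQ) (n m : ℕ) : Finset (q.Instance n) :=
  Fintype.piFinset fun j => sizeRels n (q.arity j) m

end FullCQ

/-- A one-round algorithm on `p` machines. Each relation is initially stored at a separate
location, so the bit string that machine `c` receives from `S_j` is a function of `S_j`. Afterwards
machine `c` outputs a set of tuples computed from all the bit strings that it received. -/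
structure OneRoundAlgorithm (q : FullCQ) (n p : ℕ) where
  msg : Fin p → (j : Fin q.l) → DBRel n (q.arity j) → List Bool
  out : Fin p → (Fin q.l → List Bool) → Finset (Fin q.k → Fin n)

namespace OneRoundAlgorithm

variable {q : FullCQ} {n p : ℕ}

/-- The number of bits received by machine `c` on the instance `I`. -/
def bits (A : OneRoundAlgorithm q n p) (c : Fin p) (I : q.Instance n) : ℕ :=
  ∑ j, (A.msg c j (I j)).length

/-- The output of the algorithm: the union of the outputs of the machines. -/
def output (A : OneRoundAlgorithm q n p) (I : q.Instance n) : Finset (Fin q.k → Fin n) :=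
  Finset.univ.biUnion fun c => A.out c fun j => A.msg c j (I j)

/-- On the instances in `D` the algorithm outputs only correct tuples. -/
def IsSound (A : OneRoundAlgorithm q n p) (D : Finset (q.Instance n)) : Prop :=
  ∀ I ∈ D, A.output I ⊆ q.eval I

/-- For `I` uniform in `D`, the algorithm outputs in expectation at least `E[|q(I)|]` tuples. -/
def OutputsEnough (A : OneRoundAlgorithm q n p) (D : Finset (q.Instance n)) : Prop :=
  Finset.expect D (fun I => ((q.eval I).card : ℝ)) ≤
    Finset.expect D (fun I => ((A.output I).card : ℝ))

/-- The load over the instances in `D`: the maximum of `g_c(N_c)` over all machines `c` and all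
instances, `N_c` being the number of bits that `c` receives. -/
def load (A : OneRoundAlgorithm q n p) (g : Fin p → ℕ → ℝ≥0) (D : Finset (q.Instance n)) : ℝ≥0 :=
  D.sup fun I => Finset.univ.sup fun c => g c (A.bits c I)

end OneRoundAlgorithm

/-- Well-behaved cost functions, with growth exponent `a`. -/
structure IsWellBehaved (a : ℝ) (g : ℕ → ℝ≥0) : Prop where
  map_zero : g 0 = 0
  mono : Monotone g
  growth : ∀ (x y : ℕ) (δ : ℝ), 1 ≤ x → 0 ≤ δ → (y : ℝ) = (1 + δ) * x →
    (g y : ℝ) ≤ (1 + δ) ^ a * g x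

/-- `g*(L)`, the largest `x` with `g x ≤ L`; it is `⊤` if there are arbitrarily large such `x`. -/
noncomputable def gStar (g : ℕ → ℝ≥0) (L : ℝ≥0) : ℕ∞ :=
  ⨆ (x : ℕ) (_ : g x ≤ L), (x : ℕ∞)

/-- The loads `L ≥ 0` with `∑_c g_c*(L) ^ u ≥ m ^ u`. -/
def feasibleLoads {p : ℕ} (g : Fin p → ℕ → ℝ≥0) (m : ℕ) (u : ℝ) : Set ℝ≥0 :=
  {L | (m : ℝ≥0∞) ^ u ≤ ∑ c, (gStar (g c) L : ℝ≥0∞) ^ u}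

/-- The least load in `feasibleLoads g m u`. -/
noncomputable def lowerLoad {p : ℕ} (g : Fin p → ℕ → ℝ≥0) (m : ℕ) (u : ℝ) : ℝ≥0 :=
  sInf (feasibleLoads g m u)

/-!
A message of at most `N` bits splits the relations into at most `4 ^ N` classes, and soundness
allows a machine to output only tuples all of whose projections lie in every relation of the class
at hand; call those projections revealed. Both input distributions are `β`-spread for a fixed
`β < 1`: a given set of `k` tuples is contained in the random relation with probability at most
`β ^ k`. Hence the exponential moment of base `β⁻¹` of the number of revealed tuples is at most
`4 ^ N`, and by Jensen's inequality the expected number of revealed tuples is at most `Λ * N`, where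
`Λ = log 4 / log β⁻¹`.

By symmetry each tuple lies in the random relation with the same probability, so relative to the
expected number of answers a machine outputs at most the average over `x` of the product over the
atoms of the conditional probability that the projection of `x` is revealed. By the generalized
Hölder inequality for an edge packing (Finner's inequality), this is at most
`∏ j, (Λ * N / m) ^ u j`. Summing over the machines gives `m ^ u ≤ ∑ c, (Λ * N_c) ^ u`, and the
growth condition on the cost functions turns the factor `Λ` into the factor `Λ ^ a` of the load.
-/

section RandomSets

open Finset

variable {α : Type*} [DecidableEq α]

/-- A finite family `D` of finite sets is `β`-spread if a uniformly random member of `D` contains a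
given set `A` with probability at most `β ^ #A`. -/
def IsSpread (β : ℝ) (D : Finset (Finset α)) : Prop :=
  ∀ A, (#{S ∈ D | A ⊆ S} : ℝ) ≤ β ^ #A * #D

/-- A finite family `D` of finite sets is `m`-equidistributed if a uniformly random member of `D`
contains each element of `α` with probability `m / |α|`, as happens for a symmetric family of
`m`-element sets. -/
def IsEquidistributed [Fintype α] (m : ℕ) (D : Finset (Finset α)) : Prop :=
  ∀ t, #{S ∈ D | t ∈ S} * Fintype.card α = m * #D

lemma IsSpread.mono {β β' : ℝ} {D : Finset (Finset α)} (hD : IsSpread β D) (hβ : 0 ≤ β)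
    (hle : β ≤ β') : IsSpread β' D := fun A => (hD A).trans (by gcongr)

lemma card_filter_mem_mul_card_of_symmetric {D : Finset (Finset α)} {s : Finset α} {k : ℕ}
    (hk : ∀ S ∈ D, #(s ∩ S) = k)
    (hD : ∀ t ∈ s, ∀ t' ∈ s, ∃ e : Equiv.Perm α, e t = t' ∧ ∀ S ∈ D, S.map e.toEmbedding ∈ D)
    {t : α} (ht : t ∈ s) : #{S ∈ D | t ∈ S} * #s = k * #D := by
  have hle : ∀ t₁ ∈ s, ∀ t₂ ∈ s, #{S ∈ D | t₁ ∈ S} ≤ #{S ∈ D | t₂ ∈ S} := by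
    intro t₁ ht₁ t₂ ht₂
    obtain ⟨e, rfl, he⟩ := hD t₁ ht₁ t₂ ht₂
    refine card_le_card_of_injOn (·.map e.toEmbedding) (fun S hS => ?_) (map_injective _).injOn
    have hS := mem_filter.1 hS
    exact mem_filter.2 ⟨he S hS.1, mem_map_of_mem _ hS.2⟩
  calc #{S ∈ D | t ∈ S} * #s = ∑ S ∈ D, #(s ∩ S) := by
        rw [mul_comm, sum_card_inter fun t' ht' => (hle t' ht' t ht).antisymm (hle t ht t' ht')]
    _ = k * #D := by rw [sum_congr rfl hk, sum_const, smul_eq_mul, mul_comm]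

lemma isEquidistributed_of_symmetric [Fintype α] {D : Finset (Finset α)} {m : ℕ}
    (hm : ∀ S ∈ D, #S = m)
    (hD : ∀ t t', ∃ e : Equiv.Perm α, e t = t' ∧ ∀ S ∈ D, S.map e.toEmbedding ∈ D) :
    IsEquidistributed m D := fun t => by
  simpa using card_filter_mem_mul_card_of_symmetric (s := univ) (by simpa using hm)
    (fun t _ t' _ => hD t t') (mem_univ t)

lemma IsEquidistributed.card_filter_mem_pos [Fintype α] {D : Finset (Finset α)} {m : ℕ}
    (hD : IsEquidistributed m D) (hm : 0 < m) (hne : D.Nonempty) (t : α) :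
    0 < #{S ∈ D | t ∈ S} :=
  Nat.pos_of_mul_pos_right (hD t ▸ Nat.mul_pos hm hne.card_pos)

lemma card_filter_subset_le_pow_mul {D : Finset (Finset α)} {γ : ℝ} (hγ : 0 ≤ γ) {k : ℕ}
    (hD : ∀ A, ∀ t ∉ A, #A < k →
      (#{S ∈ D | insert t A ⊆ S} : ℝ) ≤ γ * #{S ∈ D | A ⊆ S})
    (A : Finset α) (hA : #A ≤ k) : (#{S ∈ D | A ⊆ S} : ℝ) ≤ γ ^ #A * #D := by
  induction A using Finset.induction_on with
  | empty => simp
  | insert t A ht ih =>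
    rw [card_insert_of_notMem ht] at hA ⊢
    calc (#{S ∈ D | insert t A ⊆ S} : ℝ) ≤ γ * #{S ∈ D | A ⊆ S} := hD A t ht hA
      _ ≤ γ * (γ ^ #A * #D) := by gcongr; exact ih (by lia)
      _ = γ ^ (#A + 1) * #D := by ring

lemma card_filter_insert_subset_powersetCard {s A : Finset α} {m : ℕ} (hA : A ⊆ s) {t : α}
    (hts : t ∈ s) (htA : t ∉ A) :
    #{S ∈ powersetCard m s | insert t A ⊆ S} * (#s - #A) =
      (m - #A) * #{S ∈ powersetCard m s | A ⊆ S} := by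
  have hsymm : ∀ t₁ ∈ s \ A, ∀ t₂ ∈ s \ A, ∃ e : Equiv.Perm α, e t₁ = t₂ ∧
      ∀ S ∈ {S ∈ powersetCard m s | A ⊆ S},
        S.map e.toEmbedding ∈ {S ∈ powersetCard m s | A ⊆ S} := by
    intro t₁ ht₁ t₂ ht₂
    rw [mem_sdiff] at ht₁ ht₂
    refine ⟨Equiv.swap t₁ t₂, Equiv.swap_apply_left .., fun S hS => ?_⟩
    simp only [mem_filter, mem_powersetCard, card_map] at hS ⊢
    refine ⟨⟨fun x hx => ?_, hS.1.2⟩, fun x hx => ?_⟩ <;>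
      grind [mem_map_equiv, Equiv.symm_swap]
  have hcount := card_filter_mem_mul_card_of_symmetric (k := m - #A) (fun S hS => ?_) hsymm
    (mem_sdiff.2 ⟨hts, htA⟩)
  · simpa only [card_sdiff_of_subset hA, filter_filter, insert_subset_iff, and_comm] using hcount
  · simp only [mem_filter, mem_powersetCard] at hS
    rw [← hS.1.2, ← card_sdiff_of_subset hS.2, sdiff_inter_right_comm,
      inter_eq_right.2 hS.1.1]

lemma isSpread_powersetCard (s : Finset α) {m : ℕ} {θ : ℝ} (hθ₀ : 0 ≤ θ) (hθ₁ : θ ≤ 1)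
    (hm : m ≤ θ * #s) : IsSpread θ (powersetCard m s) := by
  have hms : m ≤ #s := by exact_mod_cast hm.trans (mul_le_of_le_one_left (by positivity) hθ₁)
  have hsub : ∀ {A}, ¬(A ⊆ s ∧ #A ≤ m) → #{S ∈ powersetCard m s | A ⊆ S} = 0 := by
    intro A hA
    refine card_eq_zero.2 (filter_eq_empty_iff.2 fun S hS hAS => hA ?_)
    rw [mem_powersetCard] at hS
    exact ⟨hAS.trans hS.1, hS.2 ▸ card_le_card hAS⟩
  refine fun A => card_filter_subset_le_pow_mul hθ₀ (fun A t ht _ => ?_) A le_rfl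
  by_cases hA : insert t A ⊆ s ∧ #(insert t A) ≤ m
  · rw [insert_subset_iff, card_insert_of_notMem ht] at hA
    have hcount := congrArg (Nat.cast (R := ℝ))
      (card_filter_insert_subset_powersetCard (m := m) hA.1.2 hA.1.1 ht)
    push_cast [Nat.cast_sub (show #A ≤ m by lia), Nat.cast_sub (show #A ≤ #s by lia)] at hcount
    have hpos : (0 : ℝ) < #s - #A := by
      rw [sub_pos, Nat.cast_lt]; lia
    have hratio : (m : ℝ) - #A ≤ θ * (#s - #A) := by
      have : θ * #A ≤ #A := mul_le_of_le_one_left (by positivity) hθ₁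
      linarith
    refine le_of_mul_le_mul_right ?_ hpos
    calc _ = ((m : ℝ) - #A) * #{S ∈ powersetCard m s | A ⊆ S} := hcount
      _ ≤ θ * (#s - #A) * #{S ∈ powersetCard m s | A ⊆ S} := by gcongr
      _ = _ := by ring
  · simp only [hsub hA, Nat.cast_zero]
    positivity

end RandomSets

section Messages

open Finset

lemma card_lt_pow_of_length_le {α : Type*} [Fintype α] (hα : 2 ≤ Fintype.card α)
    {s : Finset (List α)} {N : ℕ} (hs : ∀ w ∈ s, w.length ≤ N) :
    #s < Fintype.card α ^ (N + 1) := by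
  classical
  have hsub : s ⊆ (range (N + 1)).biUnion fun i => univ.image (List.ofFn : (Fin i → α) → _) :=
    fun w hw => mem_biUnion.2 ⟨w.length, mem_range.2 (Nat.lt_succ_of_le (hs w hw)),
      mem_image.2 ⟨w.get, mem_univ _, List.ofFn_get w⟩⟩
  calc #s ≤ ∑ i ∈ range (N + 1), Fintype.card α ^ i :=
        (card_le_card hsub).trans (card_biUnion_le.trans (sum_le_sum fun i _ =>
          card_image_le.trans (by simp)))
    _ < Fintype.card α ^ (N + 1) := Nat.geomSum_lt hα fun _ => mem_range.1

lemma card_le_four_pow_of_length_le {s : Finset (List Bool)} {N : ℕ}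
    (hs : ∀ w ∈ s, w.length ≤ N) : #s ≤ 4 ^ N := by
  have hlt : #s < 2 ^ (N + 1) := card_lt_pow_of_length_le (by simp) hs
  have hsq : 2 * 2 ^ N * 1 ≤ (2 ^ N) ^ 2 + 1 ^ 2 := two_mul_le_add_sq (2 ^ N) 1
  rw [← pow_mul, mul_comm N, pow_mul] at hsq
  lia

lemma sum_le_log_mul_card_of_sum_exp_le {ι : Type*} {s : Finset ι} {x : ι → ℝ} {M : ℝ}
    (hM : 0 < M) (h : ∑ i ∈ s, Real.exp (x i) ≤ M * #s) : ∑ i ∈ s, x i ≤ Real.log M * #s := by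
  have htangent : ∑ i ∈ s, (x i - Real.log M + 1) ≤ #s := calc
    _ ≤ ∑ i ∈ s, Real.exp (x i - Real.log M) := sum_le_sum fun i _ => Real.add_one_le_exp _
    _ = (∑ i ∈ s, Real.exp (x i)) / M := by simp_rw [Real.exp_sub, Real.exp_log hM, sum_div]
    _ ≤ #s := by rwa [div_le_iff₀' hM]
  simp only [sum_add_distrib, sum_sub_distrib, sum_const, nsmul_eq_mul] at htangent
  linarith

variable {α W : Type*} [Fintype α] [DecidableEq α] [DecidableEq W]

/-- The elements revealed by the message `w`: those that lie in every `S ∈ D` with message `w`. -/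
def revealed (D : Finset (Finset α)) (msg : Finset α → W) (w : W) : Finset α :=
  {t | ∀ S ∈ D, msg S = w → t ∈ S}

lemma mem_revealed {D : Finset (Finset α)} {msg : Finset α → W} {w : W} {t : α} :
    t ∈ revealed D msg w ↔ ∀ S ∈ D, msg S = w → t ∈ S := by
  simp [revealed]

lemma revealed_subset {D : Finset (Finset α)} {msg : Finset α → W} {S : Finset α} (hS : S ∈ D) :
    revealed D msg (msg S) ⊆ S := fun _ ht => mem_revealed.1 ht S hS rfl

lemma IsSpread.sum_inv_pow_card_revealed_le {β : ℝ} {D : Finset (Finset α)} (hD : IsSpread β D)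
    (hβ : 0 < β) (msg : Finset α → W) :
    ∑ S ∈ D, β⁻¹ ^ #(revealed D msg (msg S)) ≤ #(D.image msg) * #D := by
  rw [sum_comp (fun w => β⁻¹ ^ #(revealed D msg w)) msg, ← nsmul_eq_mul]
  refine sum_le_card_nsmul _ _ _ fun w _ => ?_
  have hsub : {S ∈ D | msg S = w} ⊆ {S ∈ D | revealed D msg w ⊆ S} := fun S hS => by
    obtain ⟨hSD, rfl⟩ := mem_filter.1 hS
    exact mem_filter.2 ⟨hSD, revealed_subset hSD⟩
  calc #{S ∈ D | msg S = w} • β⁻¹ ^ #(revealed D msg w)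
      ≤ β ^ #(revealed D msg w) * #D * β⁻¹ ^ #(revealed D msg w) := by
        rw [nsmul_eq_mul]
        gcongr
        exact (Nat.cast_le.2 (card_le_card hsub)).trans (hD _)
    _ = #D := by rw [mul_right_comm, ← mul_pow, mul_inv_cancel₀ hβ.ne', one_pow, one_mul]

lemma IsSpread.sum_card_revealed_le {β : ℝ} {D : Finset (Finset α)} (hD : IsSpread β D)
    (hβ₀ : 0 < β) (hβ₁ : β < 1) {Λ : ℝ} (hΛ : Real.log 4 ≤ Λ * Real.log β⁻¹)
    {msg : Finset α → List Bool} {N : ℕ} (hN : ∀ S ∈ D, (msg S).length ≤ N) :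
    ∑ S ∈ D, (#(revealed D msg (msg S)) : ℝ) ≤ Λ * N * #D := by
  have hlog : 0 < Real.log β⁻¹ := Real.log_pos ((one_lt_inv₀ hβ₀).2 hβ₁)
  have hwords : (#(D.image msg) : ℝ) ≤ 4 ^ N := by
    exact_mod_cast card_le_four_pow_of_length_le (by simpa using hN)
  have hjensen := sum_le_log_mul_card_of_sum_exp_le (s := D) (M := 4 ^ N) (by positivity)
    (x := fun S => #(revealed D msg (msg S)) * Real.log β⁻¹) <| by
      simp_rw [← Real.log_pow]
      rw [sum_congr rfl fun S _ => Real.exp_log (by positivity)]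
      exact (hD.sum_inv_pow_card_revealed_le hβ₀ msg).trans (by gcongr)
  rw [← sum_mul, Real.log_pow] at hjensen
  refine le_of_mul_le_mul_right ?_ hlog
  calc _ ≤ N * Real.log 4 * #D := hjensen
    _ ≤ N * (Λ * Real.log β⁻¹) * #D := by gcongr
    _ = Λ * N * #D * Real.log β⁻¹ := by ring

/-- The conditional probability, for `S` uniform in `D` with `t ∈ S`, that the message about `S`
reveals `t`. -/
noncomputable def revealRate (D : Finset (Finset α)) (msg : Finset α → W) (t : α) : ℝ≥0∞ :=
  #{S ∈ D | t ∈ revealed D msg (msg S)} / #{S ∈ D | t ∈ S}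

lemma revealRate_mul_card {D : Finset (Finset α)} {t : α} (ht : 0 < #{S ∈ D | t ∈ S})
    (msg : Finset α → W) :
    revealRate D msg t * #{S ∈ D | t ∈ S} = #{S ∈ D | t ∈ revealed D msg (msg S)} :=
  ENNReal.div_mul_cancel (by simpa using ht.ne') (ENNReal.natCast_ne_top _)

lemma revealRate_le_one (D : Finset (Finset α)) (msg : Finset α → W) (t : α) :
    revealRate D msg t ≤ 1 := by
  refine ENNReal.div_le_of_le_mul ?_
  rw [one_mul, Nat.cast_le]
  exact card_le_card fun S hS => mem_filter.2 ⟨(mem_filter.1 hS).1,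
    revealed_subset (mem_filter.1 hS).1 (mem_filter.1 hS).2⟩

lemma IsEquidistributed.sum_revealRate_div_card {D : Finset (Finset α)} {m : ℕ}
    (hD : IsEquidistributed m D) (msg : Finset α → W) :
    (∑ t, revealRate D msg t) / Fintype.card α =
      ((∑ S ∈ D, #(revealed D msg (msg S)) : ℕ) : ℝ≥0∞) / (m * #D : ℕ) := by
  have hcount : ∑ S ∈ D, #(revealed D msg (msg S)) =
      ∑ t, #{S ∈ D | t ∈ revealed D msg (msg S)} := by
    simp_rw [card_filter]
    rw [sum_comm]
    simp
  rw [hcount, Nat.cast_sum]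
  simp only [div_eq_mul_inv, sum_mul]
  refine sum_congr rfl fun t _ => ?_
  rw [← hD t, revealRate, div_eq_mul_inv, mul_assoc, Nat.cast_mul,
    ENNReal.mul_inv (.inr (ENNReal.natCast_ne_top _)) (.inl (ENNReal.natCast_ne_top _))]

lemma IsSpread.sum_revealRate_div_card_le {β : ℝ} {D : Finset (Finset α)} (hD : IsSpread β D)
    {m : ℕ} (hDm : IsEquidistributed m D) (hne : D.Nonempty) (hβ₀ : 0 < β) (hβ₁ : β < 1) {Λ : ℕ}
    (hΛ : Real.log 4 ≤ Λ * Real.log β⁻¹) {msg : Finset α → List Bool} {N : ℕ}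
    (hN : ∀ S ∈ D, (msg S).length ≤ N) :
    (∑ t, revealRate D msg t) / Fintype.card α ≤ (Λ * N : ℕ) / m := by
  have hsum : ∑ S ∈ D, #(revealed D msg (msg S)) ≤ Λ * N * #D := by
    exact_mod_cast hD.sum_card_revealed_le hβ₀ hβ₁ hΛ hN
  calc (∑ t, revealRate D msg t) / Fintype.card α
      ≤ ((Λ * N * #D : ℕ) : ℝ≥0∞) / (m * #D : ℕ) := by
        rw [hDm.sum_revealRate_div_card]
        gcongr
    _ = (Λ * N : ℕ) / m := by
        rw [Nat.cast_mul _ #D, Nat.cast_mul m, ENNReal.mul_div_mul_right _ _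
          (by simpa using hne.ne_empty) (ENNReal.natCast_ne_top _)]

end Messages

section Relations

open Finset

variable {n r m : ℕ}

lemma sizeRels_eq_powersetCard (n r m : ℕ) : sizeRels n r m = powersetCard m univ := by
  ext S
  simp [sizeRels, mem_powersetCard]

lemma isSpread_sizeRels {θ : ℝ} (hθ₀ : 0 ≤ θ) (hθ₁ : θ ≤ 1) (hm : m ≤ θ * (n : ℝ) ^ r) :
    IsSpread θ (sizeRels n r m) := by
  rw [sizeRels_eq_powersetCard]
  exact isSpread_powersetCard univ hθ₀ hθ₁ (by simpa using hm)

lemma sizeRels_nonempty (h : m ≤ n ^ r) : (sizeRels n r m).Nonempty := by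
  rw [sizeRels_eq_powersetCard]
  exact powersetCard_nonempty.2 (by simpa using h)

lemma isEquidistributed_sizeRels (n r m : ℕ) : IsEquidistributed m (sizeRels n r m) := by
  refine isEquidistributed_of_symmetric (fun S hS => (mem_filter.1 hS).2) fun t t' =>
    ⟨Equiv.swap t t', Equiv.swap_apply_left .., fun S hS => ?_⟩
  simpa [sizeRels] using hS

lemma mem_matchingRels {S : DBRel n r} :
    S ∈ matchingRels n r m ↔ #S = m ∧ ∀ i, ∀ a ∈ S, ∀ b ∈ S, a i = b i → a = b := by
  simp [matchingRels]

lemma map_piCongrRight_mem_matchingRels (σ : Fin r → Equiv.Perm (Fin n)) {S : DBRel n r}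
    (hS : S ∈ matchingRels n r m) :
    S.map (Equiv.piCongrRight σ).toEmbedding ∈ matchingRels n r m := by
  rw [mem_matchingRels] at hS ⊢
  refine ⟨by simpa using hS.1, fun i a ha b hb hab => ?_⟩
  obtain ⟨a', ha', rfl⟩ := mem_map.1 ha
  obtain ⟨b', hb', rfl⟩ := mem_map.1 hb
  rw [hS.2 i a' ha' b' hb' ((σ i).injective hab)]

lemma isEquidistributed_matchingRels (n r m : ℕ) : IsEquidistributed m (matchingRels n r m) :=
  isEquidistributed_of_symmetric (fun _ hS => (mem_matchingRels.1 hS).1) fun t t' =>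
    ⟨Equiv.piCongrRight fun i => Equiv.swap (t i) (t' i),
      funext fun _ => Equiv.swap_apply_left .., fun _ => map_piCongrRight_mem_matchingRels _⟩

lemma matchingRels_nonempty (hr : 0 < r) (h : m ≤ n) : (matchingRels n r m).Nonempty := by
  have : Nonempty (Fin r) := ⟨⟨0, hr⟩⟩
  obtain ⟨T, hT⟩ := powersetCard_nonempty.2 (by simpa using h : m ≤ #(univ : Finset (Fin n)))
  refine ⟨T.map ⟨Function.const (Fin r), Function.const_injective⟩, mem_matchingRels.2 ⟨?_, ?_⟩⟩
  · rw [card_map, (mem_powersetCard.1 hT).2]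
  · intro i a ha b hb hab
    obtain ⟨v, -, rfl⟩ := mem_map.1 ha
    obtain ⟨w, -, rfl⟩ := mem_map.1 hb
    exact congrArg _ hab

lemma matchingRels_eq_sizeRels_of_le_one (hr : r ≤ 1) :
    matchingRels n r m = sizeRels n r m := by
  have : Subsingleton (Fin r) := Fin.subsingleton_iff_le_one.2 hr
  ext S
  simp only [mem_matchingRels, sizeRels, mem_filter, mem_univ, true_and, and_iff_left_iff_imp]
  intro _ i a _ b _ hab
  funext i'
  rwa [Subsingleton.elim i' i]

lemma exists_perm_map_filter_insert_subset_matchingRels (hr : 2 ≤ r) {A : DBRel n r}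
    {t : Fin r → Fin n} (ht : t ∉ A) (hA : #A + 2 ≤ n) :
    ∃ e : Equiv.Perm (Fin r → Fin n), ∀ S ∈ {S ∈ matchingRels n r m | insert t A ⊆ S},
      S.map e.toEmbedding ∈ {S ∈ matchingRels n r m | A ⊆ S ∧ t ∉ S} := by
  obtain ⟨i₀, i₁, hi⟩ : ∃ i₀ i₁ : Fin r, i₁ ≠ i₀ := ⟨⟨0, by lia⟩, ⟨1, hr⟩, by simp⟩
  obtain ⟨v, -, hv⟩ : ∃ v ∈ univ, v ∉ (insert t A).image (· i₀) := by
    refine exists_mem_notMem_of_card_lt_card (card_image_le.trans_lt ?_)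
    rw [card_insert_of_notMem ht, card_fin]
    lia
  simp only [mem_image, mem_insert, not_exists, not_and] at hv
  let σ : Fin r → Equiv.Perm (Fin n) := Function.update 1 i₀ (Equiv.swap (t i₀) v)
  refine ⟨Equiv.piCongrRight σ, fun S hS => ?_⟩
  obtain ⟨hS, htA⟩ := mem_filter.1 hS
  obtain ⟨htS, hAS⟩ := insert_subset_iff.1 htA
  have hmatch := (mem_matchingRels.1 hS).2
  refine mem_filter.2 ⟨map_piCongrRight_mem_matchingRels σ hS, fun a ha => ?_, fun htS' => ?_⟩
  · have hat : a i₀ ≠ t i₀ := fun h => ht (hmatch i₀ a (hAS ha) t htS h ▸ ha)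
    refine mem_map.2 ⟨a, hAS ha, funext fun i => ?_⟩
    rcases eq_or_ne i i₀ with rfl | hne
    · simp [σ, Equiv.swap_apply_of_ne_of_ne hat (hv a (.inr ha))]
    · simp [σ, hne]
  · obtain ⟨b, hb, hbt⟩ := mem_map.1 htS'
    have hb₁ : b i₁ = t i₁ := by simpa [σ, hi] using congrFun hbt i₁
    obtain rfl := hmatch i₁ b hb t htS hb₁
    exact hv b (.inl rfl) (by simpa [σ] using (congrFun hbt i₀).symm)

lemma two_mul_card_filter_insert_subset_matchingRels_le (hr : 2 ≤ r) {A : DBRel n r}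
    {t : Fin r → Fin n} (ht : t ∉ A) (hA : #A + 2 ≤ n) :
    2 * #{S ∈ matchingRels n r m | insert t A ⊆ S} ≤ #{S ∈ matchingRels n r m | A ⊆ S} := by
  obtain ⟨e, he⟩ := exists_perm_map_filter_insert_subset_matchingRels (m := m) hr ht hA
  have hle := card_le_card_of_injOn _ he (map_injective _).injOn
  have hsplit := card_filter_add_card_filter_not (s := {S ∈ matchingRels n r m | A ⊆ S}) (t ∈ ·)
  simp only [filter_filter] at hsplit
  simp only [insert_subset_iff, and_comm (a := t ∈ _)] at hle ⊢
  lia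

lemma card_filter_subset_matchingRels_le (hr : 2 ≤ r) (A : DBRel n r) (hA : #A ≤ n - 1) :
    (#{S ∈ matchingRels n r m | A ⊆ S} : ℝ) ≤ 2⁻¹ ^ #A * #(matchingRels n r m) := by
  refine card_filter_subset_le_pow_mul (by norm_num) (fun A t ht hA => ?_) A hA
  rw [inv_mul_eq_div, le_div_iff₀' two_pos]
  exact_mod_cast two_mul_card_filter_insert_subset_matchingRels_le hr ht (by lia)

lemma card_le_of_mem_matchingRels (hr : 0 < r) {S : DBRel n r} (hS : S ∈ matchingRels n r m) :
    #S ≤ n := by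
  simpa using card_le_card_of_injOn (t := univ) (fun a : Fin r → Fin n => a ⟨0, hr⟩) (by simp)
    fun a ha b hb => (mem_matchingRels.1 hS).2 _ a ha b hb

/-- The bound `2⁻¹ ^ #A` can fail for `#A = n`, since `n - 1` tuples of a matching on all of `[n]`
determine the last one. As `n ≤ 2 * (n - 1)`, replacing `2⁻¹` by its square root absorbs this. -/
lemma isSpread_matchingRels (hr : 2 ≤ r) (hn : 2 ≤ n) :
    IsSpread (√2)⁻¹ (matchingRels n r m) := by
  intro A
  by_cases hAn : #A ≤ n
  · obtain ⟨A', hA'A, hA'⟩ := exists_subset_card_eq (min_le_left #A (n - 1))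
    have hexp : ((2 : ℝ)⁻¹) ^ #A' ≤ (√2)⁻¹ ^ #A := by
      rw [← Real.sq_sqrt (zero_le_two (α := ℝ)), ← inv_pow, ← pow_mul, Real.sqrt_sq (by simp)]
      exact pow_le_pow_of_le_one (by positivity)
        (inv_le_one_of_one_le₀ (Real.one_le_sqrt.2 one_le_two)) (by lia)
    calc (#{S ∈ matchingRels n r m | A ⊆ S} : ℝ) ≤ #{S ∈ matchingRels n r m | A' ⊆ S} := by
          gcongr
      _ ≤ 2⁻¹ ^ #A' * #(matchingRels n r m) :=
          card_filter_subset_matchingRels_le hr A' (hA' ▸ min_le_right ..)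
      _ ≤ (√2)⁻¹ ^ #A * #(matchingRels n r m) := by gcongr
  · have hempty : {S ∈ matchingRels n r m | A ⊆ S} = ∅ := filter_eq_empty_iff.2 fun S hS hAS =>
      hAn ((card_le_card hAS).trans (card_le_of_mem_matchingRels (by lia) hS))
    rw [hempty, card_empty, Nat.cast_zero]
    positivity

lemma isSpread_matchingRels_max {θ : ℝ} (hθ₀ : 0 ≤ θ) (hθ₁ : θ ≤ 1) (hr : 0 < r) (hn : 2 ≤ n)
    (hm : r = 1 → (m : ℝ) ≤ θ * n) : IsSpread (max θ (√2)⁻¹) (matchingRels n r m) := by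
  rcases (show 1 ≤ r from hr).eq_or_lt' with rfl | hr₂
  · rw [matchingRels_eq_sizeRels_of_le_one le_rfl]
    exact (isSpread_sizeRels hθ₀ hθ₁ (by simpa using hm rfl)).mono hθ₀ (le_max_left _ _)
  · exact (isSpread_matchingRels hr₂ hn).mono (by positivity) (le_max_right _ _)

end Relations

section FinnerInequality

open Finset MeasureTheory ProbabilityTheory

lemma lintegral_prod_rpow_le_of_sum_le_one {Ω κ : Type*} [MeasurableSpace Ω] {μ : Measure Ω}
    [IsProbabilityMeasure μ] (s : Finset κ) {f : κ → Ω → ℝ≥0∞}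
    (hf : ∀ j ∈ s, AEMeasurable (f j) μ) {u : κ → ℝ} (hu₀ : ∀ j ∈ s, 0 ≤ u j)
    (hu : ∑ j ∈ s, u j ≤ 1) :
    ∫⁻ ω, ∏ j ∈ s, f j ω ^ u j ∂μ ≤ ∏ j ∈ s, (∫⁻ ω, f j ω ∂μ) ^ u j := by
  simpa using ENNReal.lintegral_mul_prod_norm_pow_le s (g := fun _ => 1) aemeasurable_const hf
    (1 - ∑ j ∈ s, u j) (sub_add_cancel _ _) (sub_nonneg.2 hu) hu₀

lemma lmarginal_prod_rpow_le {ι κ : Type*} [DecidableEq ι] [Fintype κ] {X : ι → Type*}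
    [∀ i, MeasurableSpace (X i)] (μ : ∀ i, Measure (X i)) [∀ i, IsProbabilityMeasure (μ i)]
    {V : κ → Set ι} [∀ i, DecidablePred fun j => i ∈ V j] {F : κ → (∀ i, X i) → ℝ≥0∞}
    (hF : ∀ j, Measurable (F j)) (hV : ∀ j, DependsOn (F j) (V j)) {u : κ → ℝ}
    (hu₀ : ∀ j, 0 ≤ u j) {s : Finset ι} (hu : ∀ i ∈ s, ∑ j with i ∈ V j, u j ≤ 1)
    (x : ∀ i, X i) :
    lmarginal μ s (fun x => ∏ j, F j x ^ u j) x ≤ ∏ j, lmarginal μ s (F j) x ^ u j := by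
  induction s using Finset.induction_on generalizing x with
  | empty => simp
  | insert i s hi ih =>
    let G : κ → X i → ℝ≥0∞ := fun j y => lmarginal μ s (F j) (Function.update x i y)
    have hG : ∀ j, Measurable (G j) := fun j => ((hF j).lmarginal μ).comp (measurable_update x)
    have hGint : ∀ j, lmarginal μ (insert i s) (F j) x = ∫⁻ y, G j y ∂μ i := fun j =>
      lmarginal_insert _ (hF j) hi x
    have hGconst : ∀ j, i ∉ V j → ∀ y, G j y = lmarginal μ s (F j) x := by
      intro j hj y
      simp only [G, lmarginal_update_of_notMem (hF j) hi]
      congr 1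
      funext z
      exact hV j fun i' hi' => Function.update_of_ne (ne_of_mem_of_not_mem hi' hj) _ _
    calc lmarginal μ (insert i s) (fun x => ∏ j, F j x ^ u j) x
        = ∫⁻ y, lmarginal μ s (fun x => ∏ j, F j x ^ u j) (Function.update x i y) ∂μ i :=
          lmarginal_insert _ (Finset.measurable_prod _ fun j _ => (hF j).pow_const _) hi x
      _ ≤ ∫⁻ y, ∏ j, G j y ^ u j ∂μ i :=
          lintegral_mono fun y => ih (fun i' hi' => hu i' (mem_insert_of_mem hi')) _
      _ = ∫⁻ y, (∏ j with i ∈ V j, G j y ^ u j) *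
            ∏ j with i ∉ V j, lmarginal μ s (F j) x ^ u j ∂μ i := by
          refine lintegral_congr fun y => ?_
          rw [← prod_filter_mul_prod_filter_not univ (fun j => i ∈ V j)]
          congr 1
          exact prod_congr rfl fun j hj => by rw [hGconst j (mem_filter.1 hj).2]
      _ = (∫⁻ y, ∏ j with i ∈ V j, G j y ^ u j ∂μ i) *
            ∏ j with i ∉ V j, lmarginal μ s (F j) x ^ u j :=
          lintegral_mul_const _ (Finset.measurable_prod _ fun j _ => (hG j).pow_const _)
      _ ≤ (∏ j with i ∈ V j, (∫⁻ y, G j y ∂μ i) ^ u j) *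
            ∏ j with i ∉ V j, (∫⁻ y, G j y ∂μ i) ^ u j := by
          refine mul_le_mul' (lintegral_prod_rpow_le_of_sum_le_one _
            (fun j _ => (hG j).aemeasurable) (fun j _ => hu₀ j) (hu i (mem_insert_self i s)))
            (prod_congr rfl fun j hj => ?_).le
          simp [hGconst j (mem_filter.1 hj).2]
      _ = ∏ j, lmarginal μ (insert i s) (F j) x ^ u j := by
          simp_rw [hGint]
          exact prod_filter_mul_prod_filter_not _ _ _

lemma measurePreserving_comp_injective {ι κ : Type*} [Fintype ι] [Fintype κ] {X : ι → Type*}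
    [∀ i, MeasurableSpace (X i)] (μ : ∀ i, Measure (X i)) [∀ i, IsProbabilityMeasure (μ i)]
    {e : κ → ι} (he : e.Injective) :
    MeasurePreserving (fun (x : ∀ i, X i) k => x (e k)) (Measure.pi μ)
      (Measure.pi fun k => μ (e k)) := by
  refine ⟨by fun_prop, ?_⟩
  have hindep : iIndepFun (fun i (x : ∀ i, X i) => x i) (Measure.pi μ) :=
    iIndepFun_pi (X := fun _ => id) fun _ => aemeasurable_id
  rw [(iIndepFun_iff_map_fun_eq_pi_map fun k =>
    (measurable_pi_apply (e k)).aemeasurable).1 (hindep.precomp he)]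
  congr 1
  funext k
  exact (measurePreserving_eval μ (e k)).map_eq

lemma lintegral_pi_uniformOn_univ {ι α : Type*} [Fintype ι] [DecidableEq ι] [Fintype α]
    [MeasurableSpace α] [MeasurableSingletonClass α] (h : (ι → α) → ℝ≥0∞) :
    ∫⁻ x, h x ∂(Measure.pi fun _ => uniformOn Set.univ) =
      (∑ x, h x) / Fintype.card (ι → α) := by
  rw [← uniformOn_pi, Set.pi_univ, lintegral_fintype, div_eq_mul_inv, sum_mul]
  exact sum_congr rfl fun x _ => by simp [uniformOn_univ]

lemma sum_prod_rpow_div_card_le {ι κ α : Type*} [Fintype ι] [DecidableEq ι] [Fintype κ]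
    [Fintype α] [Nonempty α] {K : κ → Type*} [∀ j, Fintype (K j)] [∀ j, DecidableEq (K j)]
    (e : ∀ j, K j ↪ ι) [∀ i, DecidablePred fun j => i ∈ Set.range (e j)]
    (f : ∀ j, (K j → α) → ℝ≥0∞) {u : κ → ℝ} (hu₀ : ∀ j, 0 ≤ u j)
    (hu : ∀ i, ∑ j with i ∈ Set.range (e j), u j ≤ 1) :
    (∑ x : ι → α, ∏ j, f j (fun k => x (e j k)) ^ u j) / Fintype.card (ι → α) ≤
      ∏ j, ((∑ t, f j t) / Fintype.card (K j → α)) ^ u j := by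
  let _ : MeasurableSpace α := ⊤
  have hproj : ∀ j, ∫⁻ x : ι → α, f j (fun k => x (e j k)) ∂(.pi fun _ => uniformOn .univ) =
      ∫⁻ t, f j t ∂(.pi fun _ => uniformOn .univ) := fun j =>
    (measurePreserving_comp_injective (X := fun _ => α) _ (e j).injective).lintegral_comp
      .of_discrete
  have hdep : ∀ j, DependsOn (fun x : ι → α => f j fun k => x (e j k)) (Set.range (e j)) :=
    fun j x y hxy => congrArg (f j) (funext fun k => hxy (e j k) (Set.mem_range_self k))
  simp_rw [← lintegral_pi_uniformOn_univ, ← hproj]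
  simpa only [lmarginal_univ] using lmarginal_prod_rpow_le (fun _ => uniformOn .univ)
    (fun _ => .of_discrete) hdep hu₀ (s := univ) (fun i _ => hu i) (Classical.arbitrary _)

lemma FullCQ.IsEdgePacking.sum_nonneg {q : FullCQ} {u : Fin q.l → ℝ} (hu : q.IsEdgePacking u) :
    0 ≤ ∑ j, u j := Finset.sum_nonneg fun j _ => hu.1 j

lemma FullCQ.IsEdgePacking.le_one {q : FullCQ} {u : Fin q.l → ℝ} (hu : q.IsEdgePacking u)
    (j : Fin q.l) : u j ≤ 1 :=
  (single_le_sum (f := u) (fun j _ => hu.1 j) (by simp)).trans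
    (hu.2 (q.vars j ⟨0, q.arity_pos j⟩))

lemma FullCQ.IsEdgePacking.sum_prod_div_card_le {q : FullCQ} {u : Fin q.l → ℝ}
    (hu : q.IsEdgePacking u) {α : Type*} [Fintype α] [Nonempty α]
    {f : ∀ j, (Fin (q.arity j) → α) → ℝ≥0∞} (hf : ∀ j t, f j t ≤ 1) :
    (∑ x : Fin q.k → α, ∏ j, f j (fun i => x (q.vars j i))) / Fintype.card (Fin q.k → α) ≤
      ∏ j, ((∑ t, f j t) / Fintype.card (Fin (q.arity j) → α)) ^ u j := by
  refine le_trans ?_ (sum_prod_rpow_div_card_le q.vars f hu.1 hu.2)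
  gcongr with x _ j
  simpa using ENNReal.rpow_le_rpow_of_exponent_ge (hf j fun i => x (q.vars j i)) (hu.le_one j)

end FinnerInequality

section FullAnswers

open Finset

lemma prod_rpow_eq_rpow_sum {κ : Type*} (s : Finset κ) (y : ℝ≥0∞) {u : κ → ℝ}
    (hu : ∀ j ∈ s, 0 ≤ u j) : ∏ j ∈ s, y ^ u j = y ^ ∑ j ∈ s, u j := by
  induction s using Finset.cons_induction with
  | empty => simp
  | cons j s hj ih =>
    rw [forall_mem_cons] at hu
    rw [prod_cons, sum_cons, ih hu.2, ENNReal.rpow_add_of_nonneg _ _ hu.1 (sum_nonneg hu.2)]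

lemma update_mem_piFinset {κ : Type*} [Fintype κ] [DecidableEq κ] {α : κ → Type*}
    {D : ∀ j, Finset (α j)} {I : ∀ j, α j} (hI : I ∈ Fintype.piFinset D) {j : κ} {S : α j}
    (hS : S ∈ D j) : Function.update I j S ∈ Fintype.piFinset D := by
  rw [Fintype.mem_piFinset] at hI ⊢
  exact (Function.forall_update_iff I fun i T => T ∈ D i).2 ⟨hS, fun i _ => hI i⟩

lemma sum_card_filter_forall {κ X : Type*} [Fintype κ] [DecidableEq κ] [Fintype X]
    {α : κ → Type*} (D : ∀ j, Finset (α j)) (P : X → ∀ j, α j → Prop)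
    [∀ x j S, Decidable (P x j S)] [∀ (I : ∀ j, α j) x, Decidable (∀ j, P x j (I j))] :
    ∑ I ∈ Fintype.piFinset D, #{x | ∀ j, P x j (I j)} = ∑ x, ∏ j, #{S ∈ D j | P x j S} := by
  simp_rw [← Fintype.card_piFinset, card_filter]
  rw [sum_comm]
  refine sum_congr rfl fun x _ => ?_
  rw [← card_filter]
  congr 1
  ext I
  simp [forall_and]

namespace OneRoundAlgorithm

variable {q : FullCQ} {n p : ℕ} {A : OneRoundAlgorithm q n p}
  {D : ∀ j : Fin q.l, Finset (DBRel n (q.arity j))}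

/-- Replacing one relation by another one with the same message does not change what a machine
outputs, so by soundness the projection of the output tuple lies in every such relation. -/
lemma IsSound.projection_mem_revealed (hA : A.IsSound (Fintype.piFinset D)) {I : q.Instance n}
    (hI : I ∈ Fintype.piFinset D) {c : Fin p} {x : Fin q.k → Fin n}
    (hx : x ∈ A.out c fun j => A.msg c j (I j)) (j : Fin q.l) :
    (fun i => x (q.vars j i)) ∈ revealed (D j) (A.msg c j) (A.msg c j (I j)) := by
  refine mem_revealed.2 fun S hS hmsg => ?_
  have hsame : (fun i => A.msg c i (Function.update I j S i)) = fun i => A.msg c i (I i) := by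
    funext i
    obtain rfl | hij := eq_or_ne i j
    · rw [Function.update_self, hmsg]
    · rw [Function.update_of_ne hij]
  have hout : x ∈ A.output (Function.update I j S) :=
    mem_biUnion.2 ⟨c, mem_univ c, hsame ▸ hx⟩
  have heval := (mem_filter.1 (hA _ (update_mem_piFinset hI hS) hout)).2 j
  rwa [Function.update_self] at heval

lemma sum_prod_card_le (hA : A.IsSound (Fintype.piFinset D))
    (hE : A.OutputsEnough (Fintype.piFinset D)) (hD : ∀ j, (D j).Nonempty) :
    ∑ x : Fin q.k → Fin n, ∏ j, #{S ∈ D j | (fun i => x (q.vars j i)) ∈ S} ≤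
      ∑ c, ∑ x : Fin q.k → Fin n, ∏ j,
        #{S ∈ D j | (fun i => x (q.vars j i)) ∈ revealed (D j) (A.msg c j) (A.msg c j S)} := by
  simp_rw [← sum_card_filter_forall]
  rw [sum_comm]
  have hcard : (0 : ℝ) < #(Fintype.piFinset D) :=
    Nat.cast_pos.2 (Fintype.piFinset_nonempty.2 hD).card_pos
  have hcount : ∑ I ∈ Fintype.piFinset D, #(q.eval I) ≤
      ∑ I ∈ Fintype.piFinset D, #(A.output I) := by
    rw [OutputsEnough, expect_eq_sum_div_card, expect_eq_sum_div_card,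
      div_le_div_iff_of_pos_right hcard] at hE
    exact_mod_cast hE
  refine hcount.trans (sum_le_sum fun I hI => card_biUnion_le.trans (sum_le_sum fun c _ => ?_))
  exact card_le_card fun x hx => mem_filter.2 ⟨mem_univ x, hA.projection_mem_revealed hI hx⟩

lemma length_msg_le_sup_bits (hD : ∀ j, (D j).Nonempty) (c : Fin p) {j : Fin q.l}
    {S : DBRel n (q.arity j)} (hS : S ∈ D j) :
    (A.msg c j S).length ≤ (Fintype.piFinset D).sup (A.bits c) := by
  obtain ⟨I, hI⟩ := Fintype.piFinset_nonempty.2 hD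
  have hlength : (A.msg c j (Function.update I j S j)).length ≤
      A.bits c (Function.update I j S) :=
    single_le_sum (f := fun i => (A.msg c i (Function.update I j S i)).length)
      (fun _ _ => Nat.zero_le _) (mem_univ j)
  rw [Function.update_self] at hlength
  exact hlength.trans (le_sup (update_mem_piFinset hI hS))

lemma one_le_sum_prod_revealRate [NeZero n] (hA : A.IsSound (Fintype.piFinset D))
    (hE : A.OutputsEnough (Fintype.piFinset D)) (hD : ∀ j, (D j).Nonempty) {m : ℕ} (hm : 0 < m)
    (hDm : ∀ j, IsEquidistributed m (D j)) :
    1 ≤ ∑ c, (∑ x : Fin q.k → Fin n, ∏ j,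
      revealRate (D j) (A.msg c j) fun i => x (q.vars j i)) / Fintype.card (Fin q.k → Fin n) := by
  let N : (Fin q.k → Fin n) → ℕ := fun x => ∏ j, #{S ∈ D j | (fun i => x (q.vars j i)) ∈ S}
  have hN : ∀ x, N x = N 0 := fun x => prod_congr rfl fun j _ =>
    Nat.eq_of_mul_eq_mul_right Fintype.card_pos ((hDm j _).trans (hDm j _).symm)
  have hN₀ : (N 0 : ℝ≥0∞) ≠ 0 :=
    Nat.cast_ne_zero.2 (prod_pos fun j _ => (hDm j).card_filter_mem_pos hm (hD j) _).ne'
  have hrate : ∀ c (x : Fin q.k → Fin n),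
      ((∏ j, #{S ∈ D j | (fun i => x (q.vars j i)) ∈
        revealed (D j) (A.msg c j) (A.msg c j S)} : ℕ) : ℝ≥0∞) =
      (∏ j, revealRate (D j) (A.msg c j) fun i => x (q.vars j i)) * N 0 := by
    intro c x
    rw [← hN x, Nat.cast_prod, Nat.cast_prod, ← prod_mul_distrib]
    exact prod_congr rfl fun j _ =>
      (revealRate_mul_card ((hDm j).card_filter_mem_pos hm (hD j) _) _).symm
  have hcount : (Fintype.card (Fin q.k → Fin n) * N 0 : ℝ≥0∞) ≤
      (∑ c, ∑ x : Fin q.k → Fin n, ∏ j,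
        revealRate (D j) (A.msg c j) fun i => x (q.vars j i)) * N 0 := by
    simp_rw [sum_mul, ← hrate]
    have h := sum_prod_card_le hA hE hD
    rw [sum_congr rfl fun x _ => hN x, sum_const, card_univ, smul_eq_mul] at h
    exact_mod_cast h
  simp_rw [div_eq_mul_inv, ← sum_mul, ← div_eq_mul_inv]
  rw [ENNReal.le_div_iff_mul_le (.inl (Nat.cast_ne_zero.2 Fintype.card_ne_zero))
    (.inl (ENNReal.natCast_ne_top _)), one_mul]
  exact (ENNReal.mul_le_mul_iff_left hN₀ (ENNReal.natCast_ne_top _)).1 hcount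

theorem rpow_le_sum_rpow [NeZero n] (hA : A.IsSound (Fintype.piFinset D))
    (hE : A.OutputsEnough (Fintype.piFinset D)) (hD : ∀ j, (D j).Nonempty) {m : ℕ} (hm : 0 < m)
    (hDm : ∀ j, IsEquidistributed m (D j)) {β : ℝ} (hDβ : ∀ j, IsSpread β (D j)) (hβ₀ : 0 < β)
    (hβ₁ : β < 1) {Λ : ℕ} (hΛ : Real.log 4 ≤ Λ * Real.log β⁻¹) {u : Fin q.l → ℝ}
    (hu : q.IsEdgePacking u) :
    (m : ℝ≥0∞) ^ ∑ j, u j ≤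
      ∑ c, ((Λ * (Fintype.piFinset D).sup (A.bits c) : ℕ) : ℝ≥0∞) ^ ∑ j, u j := by
  have hratio : 1 ≤ ∑ c, (((Λ * (Fintype.piFinset D).sup (A.bits c) : ℕ) : ℝ≥0∞) / m) ^
      ∑ j, u j := by
    refine (one_le_sum_prod_revealRate hA hE hD hm hDm).trans (sum_le_sum fun c _ => ?_)
    calc (∑ x : Fin q.k → Fin n, ∏ j, revealRate (D j) (A.msg c j) fun i => x (q.vars j i)) /
          Fintype.card (Fin q.k → Fin n)
        ≤ ∏ j, ((∑ t, revealRate (D j) (A.msg c j) t) /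
            Fintype.card (Fin (q.arity j) → Fin n)) ^ u j :=
          hu.sum_prod_div_card_le fun j t => revealRate_le_one _ _ t
      _ ≤ ∏ j, (((Λ * (Fintype.piFinset D).sup (A.bits c) : ℕ) : ℝ≥0∞) / m) ^ u j :=
          prod_le_prod' fun j _ => ENNReal.rpow_le_rpow ((hDβ j).sum_revealRate_div_card_le
            (hDm j) (hD j) hβ₀ hβ₁ hΛ fun S hS => length_msg_le_sup_bits hD c hS) (hu.1 j)
      _ = _ := prod_rpow_eq_rpow_sum _ _ fun j _ => hu.1 j
  simp_rw [ENNReal.div_rpow_of_nonneg _ _ hu.sum_nonneg, div_eq_mul_inv, ← sum_mul,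
    ← div_eq_mul_inv] at hratio
  rwa [ENNReal.le_div_iff_mul_le, one_mul] at hratio
  · exact .inl (ENNReal.rpow_pos (Nat.cast_pos.2 hm) (ENNReal.natCast_ne_top m)).ne'
  · exact .inl (ENNReal.rpow_ne_top_of_nonneg hu.sum_nonneg (ENNReal.natCast_ne_top m))

end OneRoundAlgorithm

end FullAnswers

section LowerLoad

open Finset Filter Topology

lemma rpow_le_sum_rpow_of_exponent_le {κ : Type*} {s : Finset κ} (hs : s.Nonempty) {M : ℝ≥0∞}
    (hM : M ≠ ∞) {y : κ → ℝ≥0∞} {u u' : ℝ} (hu' : 0 ≤ u') (huu' : u' ≤ u)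
    (h : M ^ u ≤ ∑ c ∈ s, y c ^ u) : M ^ u' ≤ ∑ c ∈ s, y c ^ u' := by
  by_cases hbig : ∃ c ∈ s, M ≤ y c
  · obtain ⟨c, hc, hMc⟩ := hbig
    exact (ENNReal.rpow_le_rpow hMc hu').trans
      (single_le_sum (f := fun c => y c ^ u') (fun _ _ => zero_le) hc)
  push Not at hbig
  have hM₀ : 0 < M := hs.elim fun c hc => zero_le.trans_lt (hbig c hc)
  have hsplit : ∀ z : ℝ≥0∞, z ^ u = z ^ (u - u') * z ^ u' := fun z => by
    rw [← ENNReal.rpow_add_of_nonneg _ _ (sub_nonneg.2 huu') hu', sub_add_cancel]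
  refine (ENNReal.mul_le_mul_iff_right (ENNReal.rpow_pos hM₀ hM).ne'
    (ENNReal.rpow_ne_top_of_nonneg (sub_nonneg.2 huu') hM)).1 ?_
  calc M ^ (u - u') * M ^ u' = M ^ u := (hsplit M).symm
    _ ≤ ∑ c ∈ s, y c ^ u := h
    _ ≤ ∑ c ∈ s, M ^ (u - u') * y c ^ u' := sum_le_sum fun c hc => by
        rw [hsplit]
        gcongr
        exact (hbig c hc).le
    _ = M ^ (u - u') * ∑ c ∈ s, y c ^ u' := (mul_sum ..).symm

lemma le_gStar {g : ℕ → ℝ≥0} {L : ℝ≥0} {x : ℕ} (h : g x ≤ L) : (x : ℕ∞) ≤ gStar g L :=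
  le_iSup₂_of_le x h le_rfl

lemma gStar_mono (g : ℕ → ℝ≥0) : Monotone (gStar g) := fun _ _ h =>
  iSup₂_le fun _ hx => le_gStar (hx.trans h)

lemma eventually_gStar_eq {g : ℕ → ℝ≥0} (hg : Monotone g) (L : ℝ≥0) :
    ∀ᶠ L' in 𝓝[≥] L, gStar g L' = gStar g L := by
  by_cases hex : ∃ x, L < g x
  · filter_upwards [Ico_mem_nhdsGE (Nat.find_spec hex)] with L' ⟨hLL', hL'⟩
    refine le_antisymm (iSup₂_le fun x hx => le_gStar ?_) (gStar_mono g hLL')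
    exact not_lt.1 (Nat.find_min hex (hg.reflect_lt (hx.trans_lt hL')))
  · push Not at hex
    filter_upwards [self_mem_nhdsWithin] with L' hLL'
    exact le_antisymm (iSup₂_le fun x _ => le_gStar (hex x)) (gStar_mono g hLL')

lemma pos_of_log_four_le_mul {Λ : ℕ} {x : ℝ} (h : Real.log 4 ≤ Λ * x) : 0 < Λ := by
  refine Nat.pos_of_ne_zero fun hΛ => (Real.log_pos (by norm_num : (1 : ℝ) < 4)).not_ge ?_
  simpa only [hΛ, Nat.cast_zero, zero_mul] using h

lemma IsWellBehaved.map_mul_le {a : ℝ} {g : ℕ → ℝ≥0} (hg : IsWellBehaved a g) {Λ : ℕ}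
    (hΛ : 1 ≤ Λ) (x : ℕ) : g (Λ * x) ≤ (Λ : ℝ≥0) ^ a * g x := by
  obtain rfl | hx := x.eq_zero_or_pos
  · simp [hg.map_zero]
  have h := hg.growth x (Λ * x) (Λ - 1) hx (by simpa using hΛ) (by push_cast; ring)
  rw [← NNReal.coe_le_coe]
  simpa using h

variable {p : ℕ} {g : Fin p → ℕ → ℝ≥0} {m : ℕ} {u u' : ℝ}

lemma mem_feasibleLoads_of_le_gStar {L : ℝ≥0} {c : Fin p} (hu : 0 ≤ u)
    (h : (m : ℕ∞) ≤ gStar (g c) L) : L ∈ feasibleLoads g m u :=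
  (ENNReal.rpow_le_rpow (ENat.toENNReal_le.2 h) hu).trans
    (single_le_sum (f := fun c => (gStar (g c) L : ℝ≥0∞) ^ u) (fun _ _ => zero_le) (mem_univ c))

lemma feasibleLoads_nonempty (hp : 1 ≤ p) (hu : 0 ≤ u) : (feasibleLoads g m u).Nonempty :=
  ⟨g ⟨0, hp⟩ m, mem_feasibleLoads_of_le_gStar hu (le_gStar le_rfl)⟩

lemma feasibleLoads_anti (hp : 1 ≤ p) (hu' : 0 ≤ u') (huu' : u' ≤ u) :
    feasibleLoads g m u ⊆ feasibleLoads g m u' := fun _ =>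
  rpow_le_sum_rpow_of_exponent_le ⟨⟨0, hp⟩, mem_univ _⟩ (ENNReal.natCast_ne_top m) hu' huu'

lemma lowerLoad_mono (hp : 1 ≤ p) (hu' : 0 ≤ u') (huu' : u' ≤ u) :
    lowerLoad g m u' ≤ lowerLoad g m u :=
  csInf_le_csInf' (feasibleLoads_nonempty hp (hu'.trans huu')) (feasibleLoads_anti hp hu' huu')

lemma lowerLoad_zero (hp : 1 ≤ p) (hu : 0 ≤ u) : lowerLoad g 0 u = 0 :=
  nonpos_iff_eq_zero.1 (csInf_le' (mem_feasibleLoads_of_le_gStar (c := ⟨0, hp⟩) hu (by simp)))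

lemma isLeast_lowerLoad (hp : 1 ≤ p) (hg : ∀ c, Monotone (g c)) (hu : 0 ≤ u) :
    IsLeast (feasibleLoads g m u) (lowerLoad g m u) := by
  have hglb : IsGLB (feasibleLoads g m u) (lowerLoad g m u) :=
    isGLB_csInf (feasibleLoads_nonempty hp hu)
  have hstable : ∀ᶠ L in 𝓝[≥] lowerLoad g m u, ∀ c,
      gStar (g c) L = gStar (g c) (lowerLoad g m u) :=
    eventually_all.2 fun c => eventually_gStar_eq (hg c) _
  obtain ⟨L, hL, hLstable⟩ :=
    ((hglb.frequently_mem (feasibleLoads_nonempty hp hu)).and_eventually hstable).exists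
  refine ⟨?_, hglb.1⟩
  simpa only [feasibleLoads, Set.mem_ofPred_eq, hLstable] using hL

namespace OneRoundAlgorithm

variable {q : FullCQ} {n : ℕ} {A : OneRoundAlgorithm q n p}

lemma apply_sup_bits_le_load {I : Finset (q.Instance n)} (hI : I.Nonempty) (c : Fin p) :
    g c (I.sup (A.bits c)) ≤ A.load g I := by
  obtain ⟨J, hJ, hsup⟩ := exists_mem_eq_sup I hI (A.bits c)
  rw [hsup]
  exact (le_sup (f := fun c => g c (A.bits c J)) (mem_univ c)).trans
    (le_sup (f := fun J => univ.sup fun c => g c (A.bits c J)) hJ)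

theorem inv_rpow_mul_lowerLoad_le_load [NeZero n] (hp : 1 ≤ p)
    {D : ∀ j : Fin q.l, Finset (DBRel n (q.arity j))} (hA : A.IsSound (Fintype.piFinset D))
    (hE : A.OutputsEnough (Fintype.piFinset D)) (hD : ∀ j, (D j).Nonempty)
    (hDm : ∀ j, IsEquidistributed m (D j)) {β : ℝ} (hDβ : ∀ j, IsSpread β (D j)) (hβ₀ : 0 < β)
    (hβ₁ : β < 1) {Λ : ℕ} (hΛ : Real.log 4 ≤ Λ * Real.log β⁻¹) {u : Fin q.l → ℝ}
    (hu : q.IsEdgePacking u) {a : ℝ} (hg : ∀ c, IsWellBehaved a (g c)) :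
    ((Λ : ℝ≥0) ^ a)⁻¹ * lowerLoad g m (∑ j, u j) ≤ A.load g (Fintype.piFinset D) := by
  have hΛ₀ : 0 < Λ := pos_of_log_four_le_mul hΛ
  obtain rfl | hm := m.eq_zero_or_pos
  · simp [lowerLoad_zero hp hu.sum_nonneg]
  rw [inv_mul_le_iff₀ (NNReal.rpow_pos (Nat.cast_pos.2 hΛ₀))]
  refine csInf_le' ((rpow_le_sum_rpow hA hE hD hm hDm hDβ hβ₀ hβ₁ hΛ hu).trans
    (sum_le_sum fun c _ => ENNReal.rpow_le_rpow ?_ hu.sum_nonneg))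
  have hgrowth : g c (Λ * (Fintype.piFinset D).sup (A.bits c)) ≤
      (Λ : ℝ≥0) ^ a * A.load g (Fintype.piFinset D) :=
    ((hg c).map_mul_le hΛ₀ _).trans
      (by gcongr; exact apply_sup_bits_le_load (Fintype.piFinset_nonempty.2 hD) c)
  exact ENat.toENNReal_le.2 (le_gStar hgrowth)

end OneRoundAlgorithm

end LowerLoad

theorem mainTheorem6_general (θ a : ℝ) (hθ₀ : 0 < θ) (hθ₁ : θ < 1) :
    (∃ C : ℝ≥0, 0 < C ∧
      ∀ (q : FullCQ) (n m p : ℕ) (_ : 2 ≤ n) (_ : 1 ≤ p)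
        (g : Fin p → ℕ → ℝ≥0) (_ : ∀ c, IsWellBehaved a (g c))
        (u : Fin q.l → ℝ) (_ : q.IsEdgePacking u)
        (A : OneRoundAlgorithm q n p),
        ((m ≤ n ∧ ∀ j, q.arity j = 1 → (m : ℝ) ≤ θ * n) →
          A.IsSound (q.matchingDBs n m) → A.OutputsEnough (q.matchingDBs n m) →
          C * lowerLoad g m (∑ j, u j) ≤ A.load g (q.matchingDBs n m)) ∧
        ((∀ j, (m : ℝ) ≤ θ * (n : ℝ) ^ q.arity j) →
          A.IsSound (q.denseDBs n m) → A.OutputsEnough (q.denseDBs n m) →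
          C * lowerLoad g m (∑ j, u j) ≤ A.load g (q.denseDBs n m))) ∧
    ∀ (q : FullCQ) (m p : ℕ) (_ : 1 ≤ p) (g : Fin p → ℕ → ℝ≥0) (_ : ∀ c, Monotone (g c)),
      (∀ u, q.IsEdgePacking u →
        IsLeast (feasibleLoads g m (∑ j, u j)) (lowerLoad g m (∑ j, u j))) ∧
      (∀ u, q.IsMaxEdgePacking u →
        IsGreatest {L | ∃ u', q.IsEdgePacking u' ∧ L = lowerLoad g m (∑ j, u' j)}
          (lowerLoad g m (∑ j, u j))) := by
  refine ⟨?_, fun q m p hp g hg => ⟨fun u hu => isLeast_lowerLoad hp hg hu.sum_nonneg,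
    fun u hu => ⟨⟨u, hu.1, rfl⟩, ?_⟩⟩⟩
  · have hs : (√2)⁻¹ < 1 := inv_lt_one_of_one_lt₀ (Real.lt_sqrt_of_sq_lt (by norm_num))
    have hβ₀ : 0 < max θ (√2)⁻¹ := lt_max_of_lt_left hθ₀
    have hβ₁ : max θ (√2)⁻¹ < 1 := max_lt hθ₁ hs
    obtain ⟨Λ, hΛ⟩ := Archimedean.arch (Real.log 4) (Real.log_pos ((one_lt_inv₀ hβ₀).2 hβ₁))
    rw [nsmul_eq_mul] at hΛ
    refine ⟨((Λ : ℝ≥0) ^ a)⁻¹,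
      inv_pos.2 (NNReal.rpow_pos (Nat.cast_pos.2 (pos_of_log_four_le_mul hΛ))), ?_⟩
    intro q n m p hn hp g hg u hu A
    have : NeZero n := ⟨by lia⟩
    refine ⟨fun hm hA hE => OneRoundAlgorithm.inv_rpow_mul_lowerLoad_le_load hp hA hE
        (fun j => matchingRels_nonempty (q.arity_pos j) hm.1)
        (fun j => isEquidistributed_matchingRels _ _ _)
        (fun j => isSpread_matchingRels_max hθ₀.le hθ₁.le (q.arity_pos j) hn (hm.2 j))
        hβ₀ hβ₁ hΛ hu hg,
      fun hm hA hE => OneRoundAlgorithm.inv_rpow_mul_lowerLoad_le_load hp hA hE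
        (fun j => sizeRels_nonempty (by
          exact_mod_cast (hm j).trans (mul_le_of_le_one_left (by positivity) hθ₁.le)))
        (fun j => isEquidistributed_sizeRels _ _ _)
        (fun j => (isSpread_sizeRels hθ₀.le hθ₁.le (hm j)).mono hθ₀.le (le_max_left _ _))
        hβ₀ hβ₁ hΛ hu hg⟩
  · rintro L ⟨u', hu', rfl⟩
    exact lowerLoad_mono hp hu'.sum_nonneg (hu.2 u' hu')

theorem mainTheorem6 (q : FullCQ) (θ a : ℝ) (hθ₀ : 0 < θ) (hθ₁ : θ < 1) (ha : 1 < a) :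
    -- the lower bound, with a constant depending only on `q`, `θ` and `a`
    (∃ C : ℝ≥0, 0 < C ∧
      ∀ (n m p : ℕ) (_ : 2 ≤ n) (_ : 1 ≤ p)
        (g : Fin p → ℕ → ℝ≥0) (_ : ∀ c, IsWellBehaved a (g c))
        (u : Fin q.l → ℝ) (_ : q.IsEdgePacking u)
        (A : OneRoundAlgorithm q n p),
        -- matching databases
        ((m ≤ n ∧ ∀ j, q.arity j = 1 → (m : ℝ) ≤ θ * n) →
          A.IsSound (q.matchingDBs n m) → A.OutputsEnough (q.matchingDBs n m) →
          C * lowerLoad g m (∑ j, u j) ≤ A.load g (q.matchingDBs n m)) ∧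
        -- `θ`-dense databases
        ((∀ j, (m : ℝ) = θ * (n : ℝ) ^ q.arity j) →
          A.IsSound (q.denseDBs n m) → A.OutputsEnough (q.denseDBs n m) →
          C * lowerLoad g m (∑ j, u j) ≤ A.load g (q.denseDBs n m))) ∧
    ∀ (m p : ℕ) (_ : 1 ≤ p) (g : Fin p → ℕ → ℝ≥0) (_ : ∀ c, IsWellBehaved a (g c)),
      -- the minimum that defines the bound is attained
      (∀ u, q.IsEdgePacking u →
        IsLeast (feasibleLoads g m (∑ j, u j)) (lowerLoad g m (∑ j, u j))) ∧
      -- the maximum edge packing gives the best bound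
      (∀ u, q.IsMaxEdgePacking u →
        IsGreatest {L | ∃ u', q.IsEdgePacking u' ∧ L = lowerLoad g m (∑ j, u' j)}
          (lowerLoad g m (∑ j, u j))) := by
  obtain ⟨⟨C, hC, hload⟩, hopt⟩ := mainTheorem6_general θ a hθ₀ hθ₁
  exact ⟨⟨C, hC, fun n m p hn hp g hg u hu A => ⟨(hload q n m p hn hp g hg u hu A).1,
    fun hm => (hload q n m p hn hp g hg u hu A).2 fun j => (hm j).le⟩⟩,
    fun m p hp g hg => hopt q m p hp g fun c => (hg c).mono⟩
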